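/- Let $X$ be a simplicial complex on a finite linearly ordered vertex set $V$ with $|V| = n$; that is, $X$ is a collection of subsets of $V$ (its faces), closed under taking subsets and containing $\{v\}$ for every $v\in V$ (and containing $\emptyset$). The dimension of a face $\sigma$ is $|\sigma|-1$, and $X(k)$ denotes the set of $k$-dimensional faces. For a face $\sigma$ write $u\in \operatorname{lk}_X(\sigma)$ if $u\in V\setminus\sigma$ and $\sigma\cup\{u\}\in X$. For $k\ge 0$, $\sigma\in X(k)$ and $0\le j\le k+1$ let $$\sigma[j]=\Big\{u\in V \;\Big|\; u\notin \operatorname{lk}_X(\sigma),\ u\in\operatorname{lk}_X(\{v\})\text{ for all }v\in\sigma,\ \big|\{w\in\sigma : u\in\operatorname{lk}_X(\sigma\setminus\{w\})\}\big|=j\Big\}.$$ Let $G_X$ be the graph on $V$ whose edges are the $1$-dimensional faces of $X$, let $L(G_X)\in\mathbb R^{V\times V}$ be its Laplacian (vertex degrees on the diagonal, $-1$ at pairs of adjacent vertices, $0$ elsewhere), let $J\in\mathbb R^{V\times V}$ be the all-ones matrix, and let $\lambda_1(L(G_X)+J)\le\dots\le\lambda_n(L(G_X)+J)$ be the eigenvalues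 of the symmetric matrix $L(G_X)+J$, counted with multiplicity. Let $\widetilde H^k(X;\mathbb R)$ be the $k$-th reduced simplicial cohomology of $X$ with real coefficients. Then for every integer $k\ge 0$, $$\dim \widetilde H^k(X;\mathbb R)\ \le\ \left|\left\{A\subseteq\{1,\dots,n\} \;\middle|\; |A|=k+1,\ \sum_{i\in A}\lambda_i(L(G_X)+J)\le kn+\max_{\sigma\in X(k)}\sum_{j=0}^{k+1}(j+1)\,\big|\sigma[j]\big|\right\}\right|,$$ where the maximum is read as $0$ if $X(k)=\emptyset$. -/

import Mathlib

namespace AbstractSimplicialComplex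

/-- A face of the complex in the convention where the empty set counts as a face
(of dimension `-1`). Mathlib's complexes only record the nonempty faces. -/
def IsFace {V : Type*} (X : AbstractSimplicialComplex V) (σ : Finset V) : Prop :=
  σ = ∅ ∨ σ ∈ X

theorem IsFace.mono {V : Type*} {X : AbstractSimplicialComplex V} {σ τ : Finset V}
    (hτ : X.IsFace τ) (h : σ ⊆ τ) : X.IsFace σ := by
  rcases σ.eq_empty_or_nonempty with h0 | h0
  · exact Or.inl h0
  · rcases hτ with rfl | hτ
    · exact Or.inl (Finset.subset_empty.mp h)
    · exact Or.inr ((X.isRelLowerSet_faces hτ).2 h h0)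

/-- The faces with exactly `p` vertices, i.e. the faces of dimension `p - 1`. Thus
`X(k)` is `X.facesCard (k + 1)`, and `X(-1) = {∅}` is `X.facesCard 0`. -/
noncomputable def facesCard {V : Type*} [Fintype V] (X : AbstractSimplicialComplex V) (p : ℕ) :
    Finset (Finset V) :=
  open Classical in Finset.univ.filter fun σ => X.IsFace σ ∧ σ.card = p

theorem mem_facesCard {V : Type*} [Fintype V] {X : AbstractSimplicialComplex V} {p : ℕ}
    {σ : Finset V} : σ ∈ X.facesCard p ↔ X.IsFace σ ∧ σ.card = p := by
  simp [facesCard]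

theorem erase_mem_facesCard {V : Type*} [Fintype V] [DecidableEq V]
    {X : AbstractSimplicialComplex V} {p : ℕ} {τ : Finset V} (hτ : τ ∈ X.facesCard (p + 1))
    {u : V} (hu : u ∈ τ) : τ.erase u ∈ X.facesCard p := by
  rw [mem_facesCard] at hτ ⊢
  exact ⟨hτ.1.mono (Finset.erase_subset u τ), by rw [Finset.card_erase_of_mem hu, hτ.2]; rfl⟩

/-- The link `{τ ∈ X | σ ∪ τ ∈ X, σ ∩ τ = ∅}` of a face `σ`. -/
def link {V : Type*} [DecidableEq V] (X : AbstractSimplicialComplex V) (σ : Finset V) :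
    Set (Finset V) :=
  {τ | X.IsFace τ ∧ X.IsFace (σ ∪ τ) ∧ σ ∩ τ = ∅}

/-- The underlying graph `G_X`: the `1`-skeleton of `X`, viewed as a graph on `V`. -/
def skeletonGraph {V : Type*} [DecidableEq V] (X : AbstractSimplicialComplex V) :
    SimpleGraph V where
  Adj u v := u ≠ v ∧ ({u, v} : Finset V) ∈ X
  symm := ⟨fun u v h => ⟨h.1.symm, by rw [Finset.pair_comm]; exact h.2⟩⟩
  loopless := ⟨fun _ h => h.1 rfl⟩

/-- The set `σ[j]` of the vertices `u` with `u ∉ lk(σ)`, with `u ∈ lk(v)` for all `v ∈ σ`, and with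
`u ∈ lk(σ \ {w})` for exactly `j` of the vertices `w ∈ σ`. -/
noncomputable def defect {V : Type*} [Fintype V] [DecidableEq V]
    (X : AbstractSimplicialComplex V) (σ : Finset V) (j : ℕ) : Finset V :=
  open Classical in
  Finset.univ.filter fun u =>
    ({u} : Finset V) ∉ X.link σ ∧ (∀ v ∈ σ, ({u} : Finset V) ∈ X.link {v}) ∧
      (σ.filter fun w => ({u} : Finset V) ∈ X.link (σ \ {w})).card = j

/-- The quantity `max_{σ ∈ X(k)} ∑_{j=0}^{k+1} (j+1) |σ[j]|`
(a maximum of natural numbers, with value `0` if `X` has no `k`-dimensional face). -/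
noncomputable def maxDefect {V : Type*} [Fintype V] [DecidableEq V]
    (X : AbstractSimplicialComplex V) (k : ℕ) : ℕ :=
  (X.facesCard (k + 1)).sup fun σ =>
    ∑ j ∈ Finset.range (k + 2), (j + 1) * (X.defect σ j).card

/-- The matrix `L(G_X) + J`, with `L` the graph Laplacian and `J` the all-ones matrix. -/
noncomputable def lapAddOnes {V : Type*} [Fintype V] [DecidableEq V]
    (X : AbstractSimplicialComplex V) : Matrix V V ℝ :=
  open Classical in X.skeletonGraph.lapMatrix ℝ + Matrix.of fun _ _ => 1

theorem isHermitian_lapAddOnes {V : Type*} [Fintype V] [DecidableEq V]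
    (X : AbstractSimplicialComplex V) : X.lapAddOnes.IsHermitian := by
  classical
  unfold lapAddOnes
  refine Matrix.IsHermitian.add ?_ ?_
  · convert X.skeletonGraph.isHermitian_lapMatrix ℝ
  · ext i j
    simp

/-- The position sign `(-1)^|{v ∈ τ : v < u}|` of a vertex `u` in `τ`. -/
def sign {V : Type*} [LinearOrder V] (τ : Finset V) (u : V) : ℝ :=
  (-1) ^ (τ.filter fun v => v < u).card

/-- Real simplicial cochains of dimension `p - 1` of the augmented complex: real functions on the
set of faces with `p` vertices. -/
abbrev Cochain {V : Type*} [Fintype V] (X : AbstractSimplicialComplex V) (p : ℕ) : Type _ :=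
  {σ : Finset V // σ ∈ X.facesCard p} → ℝ

/-- The simplicial coboundary map (the transpose of the boundary map) from cochains of dimension
`p - 1` to cochains of dimension `p`:
`(δ f)(τ) = ∑_{u ∈ τ} (-1)^|{v ∈ τ : v < u}| f(τ \ {u})`. For `p = 0` it is the augmentation. -/
def coboundary {V : Type*} [Fintype V] [LinearOrder V] (X : AbstractSimplicialComplex V)
    (p : ℕ) : X.Cochain p →ₗ[ℝ] X.Cochain (p + 1) where
  toFun f τ := ∑ u : {u : V // u ∈ τ.1},
    sign τ.1 u.1 * f ⟨τ.1.erase u.1, erase_mem_facesCard τ.2 u.2⟩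
  map_add' f g := by
    funext τ
    simp [mul_add, Finset.sum_add_distrib]
  map_smul' c f := by
    funext τ
    simp [Finset.mul_sum, mul_left_comm]

theorem sign_mul_sign_erase_of_lt {V : Type*} [LinearOrder V] {τ : Finset V} {u w : V}
    (hw : w ∈ τ) (h : w < u) :
    sign τ u * sign (τ.erase u) w = -(sign τ w * sign (τ.erase w) u) := by
  have h1 : (τ.erase u).filter (fun v => v < w) = τ.filter fun v => v < w := by
    ext v
    simp only [Finset.mem_filter, Finset.mem_erase]
    exact ⟨fun hv => ⟨hv.1.2, hv.2⟩, fun hv => ⟨⟨(hv.2.trans h).ne, hv.1⟩, hv.2⟩⟩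
  have h2 : (τ.erase w).filter (fun v => v < u) = (τ.filter fun v => v < u).erase w :=
    Finset.filter_erase _ _ _
  have h3 : ((τ.filter fun v => v < u).erase w).card + 1 = (τ.filter fun v => v < u).card :=
    Finset.card_erase_add_one (by simp [hw, h])
  unfold sign
  rw [h1, h2, ← h3]
  ring

theorem sign_mul_sign_erase {V : Type*} [LinearOrder V] {τ : Finset V} {u w : V}
    (hu : u ∈ τ) (hw : w ∈ τ) (h : u ≠ w) :
    sign τ u * sign (τ.erase u) w = -(sign τ w * sign (τ.erase w) u) := by
  rcases lt_or_gt_of_ne h with h | h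
  · rw [sign_mul_sign_erase_of_lt hu h, neg_neg]
  · exact sign_mul_sign_erase_of_lt hw h

theorem coboundary_coboundary {V : Type*} [Fintype V] [LinearOrder V]
    (X : AbstractSimplicialComplex V) (p : ℕ) (f : X.Cochain p) :
    X.coboundary (p + 1) (X.coboundary p f) = 0 := by
  classical
  funext τ
  let g : Finset V → ℝ := fun s => if h : s ∈ X.facesCard p then f ⟨s, h⟩ else 0
  let F : V → V → ℝ := fun u w =>
    if u = w then 0 else sign τ.1 u * sign (τ.1.erase u) w * g ((τ.1.erase u).erase w)
  have hF : ∀ u ∈ τ.1, ∀ w ∈ τ.1, F u w = -F w u := by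
    intro u hu w hw
    by_cases h : u = w
    · simp [F, h]
    · simp only [F, h, Ne.symm h, if_false]
      rw [sign_mul_sign_erase hu hw h, Finset.erase_right_comm]
      ring
  have h1 : X.coboundary (p + 1) (X.coboundary p f) τ = ∑ u ∈ τ.1, ∑ w ∈ τ.1, F u w := by
    rw [← Finset.sum_coe_sort τ.1]
    refine Finset.sum_congr rfl fun u _ => ?_
    have h2 : ∑ w ∈ τ.1, F u.1 w = ∑ w ∈ τ.1.erase u.1, F u.1 w := by
      refine (Finset.sum_erase _ ?_).symm
      simp [F]
    rw [h2, ← Finset.sum_coe_sort (τ.1.erase u.1)]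
    simp only [coboundary, LinearMap.coe_mk, AddHom.coe_mk, Finset.mul_sum]
    refine Finset.sum_congr rfl fun w _ => ?_
    have hne : u.1 ≠ w.1 := (Finset.ne_of_mem_erase w.2).symm
    have hm : (τ.1.erase u.1).erase w.1 ∈ X.facesCard p :=
      erase_mem_facesCard (erase_mem_facesCard τ.2 u.2) w.2
    simp only [F, g, hne, hm, if_false, dif_pos, mul_assoc]
  have h3 : ∑ u ∈ τ.1, ∑ w ∈ τ.1, F u w = -∑ u ∈ τ.1, ∑ w ∈ τ.1, F u w := by
    conv_lhs => rw [Finset.sum_comm]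
    rw [← Finset.sum_neg_distrib]
    refine Finset.sum_congr rfl fun u hu => ?_
    rw [← Finset.sum_neg_distrib]
    exact Finset.sum_congr rfl fun w hw => hF w hw u hu
  rw [h1, Pi.zero_apply]
  linarith

/-- The `k`-th reduced simplicial cohomology `H̃^k(X; ℝ)`: cocycles of dimension `k` modulo
coboundaries, in the augmented cochain complex (so for `k = 0` the constants are divided out). -/
abbrev ReducedCohomology {V : Type*} [Fintype V] [LinearOrder V]
    (X : AbstractSimplicialComplex V) (k : ℕ) : Type _ :=
  LinearMap.ker (X.coboundary (k + 1)) ⧸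
    LinearMap.range ((X.coboundary k).codRestrict (LinearMap.ker (X.coboundary (k + 1)))
      fun f => LinearMap.mem_ker.mpr (X.coboundary_coboundary k f))

end AbstractSimplicialComplex

/-- The eigenvalues of a real symmetric matrix, with multiplicity, in increasing order
(Mathlib's `eigenvalues₀` lists them in decreasing order). The index runs over `0, …, n - 1`. -/
noncomputable def ascEigenvalue {V : Type*} [Fintype V] [DecidableEq V] {M : Matrix V V ℝ}
    (hM : M.IsHermitian) (i : Fin (Fintype.card V)) : ℝ :=
  hM.eigenvalues₀ i.rev

/-! A cohomology class has a harmonic representative: a cocycle orthogonal to the coboundaries.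
Extended by zero, it becomes an element `g` of the exterior power `Λ^(k+1) ℝ^V`, where `M = L + J`
acts through its additive compound, whose eigenvalues are the sums of `λ_i` over `(k+1)`-sets `A`.
Let `c` be the threshold in the theorem. Harmonicity forces the form to be at most `c‖g‖²`
(`sum_dotProduct_lapAddOnes_le`), while vanishing of all coordinates of `g` with eigenvalue at most
`c` forces it above `c‖g‖²` unless `g = 0` (`mul_lt_energy`). So these coordinates separate harmonic
cochains, and their number bounds the dimension (`finrank_quotient_le_card`).

For the upper bound, orthogonality to coboundaries kills the `J` term, and the cocycle identity
`sum_coface_sq` cancels the Laplacian cross terms except on the edges of `OpenEdge`. The rest is a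
count at each face, `card_adj_add_card_openEdge_le`. -/

theorem exists_eigenframe {V : Type*} [Fintype V] [DecidableEq V] {M : Matrix V V ℝ}
    (hM : M.IsHermitian) :
    ∃ U : Fin (Fintype.card V) → V → ℝ, (∀ h, ∑ i, (U i ⬝ᵥ h) ^ 2 = h ⬝ᵥ h) ∧
      ∀ h, ∑ i, ascEigenvalue hM i * (U i ⬝ᵥ h) ^ 2 = h ⬝ᵥ (M.mulVec h) := by
  let b := hM.eigenvectorBasis
  -- The indexing behind `Matrix.IsHermitian.eigenvalues`, preceded by the reversal in
  -- `ascEigenvalue`.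
  let e : Fin (Fintype.card V) ≃ V :=
    Fin.revPerm.trans (Fintype.equivOfCardEq (Fintype.card_fin _))
  have hlam : ∀ i, ascEigenvalue hM i = hM.eigenvalues (e i) := by
    intro i
    simp [ascEigenvalue, Matrix.IsHermitian.eigenvalues, e]
  have hin : ∀ x y : V → ℝ, x ⬝ᵥ y = inner ℝ (WithLp.toLp 2 x) (WithLp.toLp 2 y) := by
    intro x y
    simp [EuclideanSpace.inner_toLp_toLp, dotProduct_comm]
  have hpars : ∀ x y : V → ℝ, ∑ v, (⇑(b v) ⬝ᵥ x) * (⇑(b v) ⬝ᵥ y) = x ⬝ᵥ y := by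
    intro x y
    rw [hin x y, ← b.sum_inner_mul_inner]
    refine Finset.sum_congr rfl fun v _ => ?_
    rw [hin, hin, real_inner_comm]
  refine ⟨fun i => ⇑(b (e i)), fun h => ?_, fun h => ?_⟩
  · rw [← hpars, ← e.sum_comp]
    exact Finset.sum_congr rfl fun i _ => sq _
  · rw [← hpars, ← e.sum_comp]
    refine Finset.sum_congr rfl fun i _ => ?_
    have h1 : ⇑(b (e i)) ⬝ᵥ M.mulVec h = hM.eigenvalues (e i) * (⇑(b (e i)) ⬝ᵥ h) := by
      have hT : M.transpose = M := by
        simpa [Matrix.conjTranspose_eq_transpose_of_trivial] using hM.eq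
      rw [Matrix.dotProduct_mulVec, ← Matrix.mulVec_transpose, hT,
        hM.mulVec_eigenvectorBasis, smul_dotProduct, smul_eq_mul]
    rw [h1, hlam]
    ring

/-! ### Contractions in the exterior algebra -/

namespace AbstractSimplicialComplex

variable {V : Type*} [LinearOrder V]

theorem sign_insert_self (ρ : Finset V) (u : V) : sign (insert u ρ) u = sign ρ u := by
  simp [sign, Finset.filter_insert]

theorem sign_mul_self (ρ : Finset V) (u : V) : sign ρ u * sign ρ u = 1 := by
  rw [sign, ← mul_pow]
  simp

theorem sign_mul_sign_insert {ρ : Finset V} {u v : V} (hu : u ∉ ρ) (hv : v ∉ ρ) (h : u ≠ v) :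
    sign ρ u * sign (insert u ρ) v = -(sign ρ v * sign (insert v ρ) u) := by
  have h1 := sign_mul_sign_erase (τ := insert u (insert v ρ)) (u := u) (w := v)
    (by simp) (by simp) h
  rw [Finset.erase_insert (by simp [h, hu]), sign_insert_self (insert v ρ) u, sign_insert_self ρ v,
    Finset.insert_comm u v, Finset.erase_insert (by simp [h.symm, hv]),
    sign_insert_self (insert u ρ) v, sign_insert_self ρ u] at h1
  linarith

/-- The signed values of a function on finite sets at the sets `ρ ∪ {u}` with `u ∉ ρ`. -/
def slice (g : Finset V → ℝ) (ρ : Finset V) (u : V) : ℝ :=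
  if u ∈ ρ then 0 else sign ρ u * g (insert u ρ)

theorem slice_sq (g : Finset V → ℝ) (ρ : Finset V) (u : V) :
    slice g ρ u ^ 2 = if u ∈ ρ then 0 else g (insert u ρ) ^ 2 := by
  unfold slice
  split_ifs
  · simp
  · rw [mul_pow, sq (sign ρ u), sign_mul_self, one_mul]

/-- Double counting of flags `u ∈ σ` through `σ = ρ ∪ {u}`; it moves every estimate between slices
and faces. -/
theorem sum_compl_insert [Fintype V] (φ : Finset V → V → ℝ) :
    ∑ ρ, ∑ u, (if u ∈ ρ then 0 else φ (insert u ρ) u) = ∑ σ, ∑ u ∈ σ, φ σ u := by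
  have h1 : ∀ ρ : Finset V, ∑ u, (if u ∈ ρ then 0 else φ (insert u ρ) u)
      = ∑ u ∈ ρᶜ, φ (insert u ρ) u := by
    intro ρ
    rw [← Finset.sum_subset (Finset.subset_univ ρᶜ) fun u _ hu => if_pos (by simpa using hu)]
    exact Finset.sum_congr rfl fun u hu => if_neg (by simpa using hu)
  simp only [h1]
  rw [Finset.sum_sigma', Finset.sum_sigma']
  refine Finset.sum_bij' (fun x _ => ⟨insert x.2 x.1, x.2⟩) (fun x _ => ⟨x.1.erase x.2, x.2⟩)
    ?_ ?_ ?_ ?_ ?_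
  · simp
  · simp
  · rintro ⟨a, u⟩ h
    simp only [Finset.mem_sigma, Finset.mem_univ, Finset.mem_compl, true_and] at h
    simp [Finset.erase_insert h]
  · rintro ⟨a, u⟩ h
    simp only [Finset.mem_sigma, Finset.mem_univ, true_and] at h
    simp [Finset.insert_erase h]
  · simp

variable [Fintype V]

/-- Contraction of a function on finite sets, thought of as an element of the exterior algebra,
by a vector. -/
def contract (w : V → ℝ) (g : Finset V → ℝ) (ρ : Finset V) : ℝ := w ⬝ᵥ slice g ρ

theorem contract_anticomm (w w' : V → ℝ) (g : Finset V → ℝ) :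
    contract w (contract w' g) = -contract w' (contract w g) := by
  have key : ∀ (a b : V → ℝ) (ρ : Finset V), contract a (contract b g) ρ = ∑ u, ∑ v,
      a u * b v * (if u ∈ ρ ∨ v ∈ ρ ∨ u = v then 0 else
        sign ρ u * sign (insert u ρ) v * g (insert u (insert v ρ))) := by
    intro a b ρ
    simp only [contract, dotProduct]
    refine Finset.sum_congr rfl fun u _ => ?_
    rw [slice]
    split_ifs with hu
    · simp [hu]
    · rw [contract, dotProduct, Finset.mul_sum, Finset.mul_sum]
      refine Finset.sum_congr rfl fun v _ => ?_
      simp only [slice, Finset.mem_insert, hu, false_or]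
      by_cases hv : v ∈ ρ
      · simp [hv]
      · by_cases huv : v = u
        · simp [huv]
        · simp only [hv, huv, Ne.symm huv, or_self, if_false]
          rw [Finset.insert_comm]
          ring
  funext ρ
  rw [Pi.neg_apply, key, key, Finset.sum_comm, ← Finset.sum_neg_distrib]
  refine Finset.sum_congr rfl fun u _ => ?_
  rw [← Finset.sum_neg_distrib]
  refine Finset.sum_congr rfl fun v _ => ?_
  by_cases hu : u ∈ ρ
  · simp [hu]
  by_cases hv : v ∈ ρ
  · simp [hv]
  by_cases huv : u = v
  · simp [huv]
  · simp only [hu, hv, huv, Ne.symm huv, or_self, if_false]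
    rw [sign_mul_sign_insert hv hu (Ne.symm huv), Finset.insert_comm u v]
    ring

theorem contract_add (w : V → ℝ) (g g' : Finset V → ℝ) :
    contract w (g + g') = contract w g + contract w g' := by
  funext ρ
  simp only [contract, Pi.add_apply, ← dotProduct_add]
  congr 1
  funext u
  simp only [slice, Pi.add_apply]
  split_ifs <;> ring

theorem contract_smul (w : V → ℝ) (c : ℝ) (g : Finset V → ℝ) :
    contract w (c • g) = c • contract w g := by
  funext ρ
  simp only [contract, Pi.smul_apply, ← dotProduct_smul]
  congr 1
  funext u
  simp only [slice, Pi.smul_apply, smul_eq_mul]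
  split_ifs <;> ring

/-- A function on finite sets is homogeneous of degree `p` if it is supported on the sets with `p`
elements. -/
def Homogeneous (p : ℕ) (g : Finset V → ℝ) : Prop := ∀ σ, g σ ≠ 0 → σ.card = p

theorem Homogeneous.contract {p : ℕ} {g : Finset V → ℝ} (hg : Homogeneous (p + 1) g)
    (w : V → ℝ) : Homogeneous p (contract w g) := by
  intro ρ h
  obtain ⟨u, -, hu⟩ := Finset.exists_ne_zero_of_sum_ne_zero h
  have h1 := right_ne_zero_of_mul hu
  simp only [slice, ne_eq, ite_eq_left_iff, not_forall] at h1
  obtain ⟨h2, h3⟩ := h1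
  have := hg _ (right_ne_zero_of_mul h3)
  rw [Finset.card_insert_of_notMem h2] at this
  omega

theorem sum_slice_sq {p : ℕ} {g : Finset V → ℝ} (hg : Homogeneous p g) :
    ∑ ρ, slice g ρ ⬝ᵥ slice g ρ = p * ∑ σ, g σ ^ 2 := by
  have h1 : ∀ ρ, slice g ρ ⬝ᵥ slice g ρ =
      ∑ u, if u ∈ ρ then 0 else g (insert u ρ) ^ 2 := by
    intro ρ
    refine Finset.sum_congr rfl fun u _ => ?_
    rw [← sq, slice_sq]
  simp only [h1]
  rw [sum_compl_insert fun σ _ => g σ ^ 2, Finset.mul_sum]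
  refine Finset.sum_congr rfl fun σ _ => ?_
  rw [Finset.sum_const, nsmul_eq_mul]
  by_cases h : g σ = 0
  · simp [h]
  · rw [hg σ h]

section Coord

variable {ι : Type*} (U : ι → V → ℝ)

/-- `contract` as a linear map. -/
def contractLinear (w : V → ℝ) : (Finset V → ℝ) →ₗ[ℝ] (Finset V → ℝ) where
  toFun := contract w
  map_add' := contract_add w
  map_smul' := contract_smul w

/-- The coordinate of a function along the wedge product of the vectors `U i`, for `i` in a
list. -/
def coord : List ι → (Finset V → ℝ) →ₗ[ℝ] ℝ
  | [] => LinearMap.proj ∅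
  | i :: l => (coord l).comp (contractLinear (U i))

theorem coord_cons (i : ι) (l : List ι) (g : Finset V → ℝ) :
    coord U (i :: l) g = coord U l (contract (U i) g) := rfl

/-- Swapping two contractions only changes a sign, and only vanishing matters, so signs are not
tracked. -/
theorem coord_eq_zero_of_perm {l l' : List ι} (h : l.Perm l') :
    ∀ g, coord U l g = 0 → coord U l' g = 0 := by
  induction h with
  | nil => exact fun _ h => h
  | cons x _ ih => exact fun g h => ih _ h
  | swap x y l =>
    intro g h
    rw [coord_cons, coord_cons] at h ⊢
    rw [contract_anticomm, map_neg, h, neg_zero]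
  | trans _ _ ih1 ih2 => exact fun g h => ih2 g (ih1 g h)

theorem coord_eq_zero_of_not_nodup [DecidableEq ι] {l : List ι} (h : ¬ l.Nodup)
    (g : Finset V → ℝ) : coord U l g = 0 := by
  obtain ⟨i, hi⟩ : ∃ i, 1 < l.count i := by
    by_contra hc
    push Not at hc
    exact h (List.nodup_iff_count_le_one.mpr hc)
  have h1 : i ∈ l := List.count_pos_iff.mp (by omega)
  have h2 : i ∈ l.erase i := by
    apply List.count_pos_iff.mp
    rw [List.count_erase_self]
    omega
  have hp : l.Perm (i :: i :: (l.erase i).erase i) :=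
    (List.perm_cons_erase h1).trans ((List.perm_cons_erase h2).cons i)
  apply coord_eq_zero_of_perm U hp.symm
  rw [coord_cons, coord_cons]
  have h3 : contract (U i) (contract (U i) g) = 0 := by
    have := contract_anticomm (U i) (U i) g
    exact self_eq_neg.mp this
  rw [h3, map_zero]

end Coord

/-! ### Spectral lower bound for the additive compound -/

section Frame

variable {ι : Type*} [Fintype ι] (U : ι → V → ℝ) (lam : ι → ℝ)

/-- The quadratic form of the additive compound of the matrix `∑ i, lam i • U i ⊗ U i`. -/
def energy (g : Finset V → ℝ) : ℝ := ∑ i, lam i * ∑ ρ, contract (U i) g ρ ^ 2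

theorem energy_eq {M : Matrix V V ℝ} (hM : ∀ h, ∑ i, lam i * (U i ⬝ᵥ h) ^ 2 = h ⬝ᵥ M.mulVec h)
    (g : Finset V → ℝ) : energy U lam g = ∑ ρ, slice g ρ ⬝ᵥ M.mulVec (slice g ρ) := by
  simp only [energy, ← hM, contract, Finset.mul_sum]
  exact Finset.sum_comm

variable {U}

theorem sum_contract_sq (hU : ∀ h, ∑ i, (U i ⬝ᵥ h) ^ 2 = h ⬝ᵥ h) {p : ℕ} {g : Finset V → ℝ}
    (hg : Homogeneous p g) : ∑ i, ∑ ρ, contract (U i) g ρ ^ 2 = p * ∑ σ, g σ ^ 2 := by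
  rw [← sum_slice_sq hg, Finset.sum_comm]
  exact Finset.sum_congr rfl fun ρ _ => hU _

/-- After anticommuting the two contractions, the Parseval identity `sum_contract_sq` applies to
`contract (U j) g`, of degree `p`. -/
theorem sum_energy_contract (hU : ∀ h, ∑ i, (U i ⬝ᵥ h) ^ 2 = h ⬝ᵥ h) {p : ℕ}
    {g : Finset V → ℝ} (hg : Homogeneous (p + 1) g) :
    ∑ i, energy U lam (contract (U i) g) = p * energy U lam g := by
  simp only [energy]
  rw [Finset.sum_comm, Finset.mul_sum]
  refine Finset.sum_congr rfl fun j _ => ?_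
  rw [← Finset.mul_sum, mul_left_comm, ← sum_contract_sq hU (hg.contract (U j))]
  congr 1
  refine Finset.sum_congr rfl fun i _ => Finset.sum_congr rfl fun ρ _ => ?_
  rw [contract_anticomm, Pi.neg_apply, neg_sq]

/-- Induction on the degree avoids building an eigenbasis of the exterior power. Contraction by `U
i` lowers the threshold to `c - lam i`; summing over `i` gives `c(p+1)‖g‖² - energy < p · energy`.
-/
theorem mul_lt_energy (hU : ∀ h, ∑ i, (U i ⬝ᵥ h) ^ 2 = h ⬝ᵥ h) (p : ℕ) :
    ∀ (c : ℝ) (g : Finset V → ℝ), Homogeneous p g → g ≠ 0 →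
      (∀ l : List ι, l.length = p → (l.map lam).sum ≤ c → coord U l g = 0) →
      c * ∑ σ, g σ ^ 2 < energy U lam g := by
  induction p with
  | zero =>
    intro c g hg hne hl
    have hemp : g ∅ ≠ 0 := by
      obtain ⟨σ, hσ⟩ := Function.ne_iff.mp hne
      have := Finset.card_eq_zero.mp (hg σ hσ)
      rwa [this] at hσ
    -- The empty list has sum `0` and coordinate `g ∅ ≠ 0`.
    have hc : c < 0 := by
      by_contra hc
      exact hemp (hl [] rfl (by simpa using hc))
    have hpos : 0 < ∑ σ, g σ ^ 2 :=
      Finset.sum_pos' (fun σ _ => sq_nonneg _) ⟨∅, Finset.mem_univ _, by positivity⟩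
    have hs : ∀ ρ, slice g ρ = 0 := by
      intro ρ
      funext u
      simp only [slice, Pi.zero_apply, ite_eq_left_iff]
      intro _
      by_contra h
      have := hg _ (right_ne_zero_of_mul h)
      simp at this
    have h0 : energy U lam g = 0 := by
      simp [energy, contract, hs]
    rw [h0]
    exact mul_neg_of_neg_of_pos hc hpos
  | succ p ih =>
    intro c g hg hne hl
    have hpos : 0 < ∑ σ, g σ ^ 2 := by
      obtain ⟨σ, hσ⟩ := Function.ne_iff.mp hne
      refine Finset.sum_pos' (fun σ _ => sq_nonneg _) ⟨σ, Finset.mem_univ _, ?_⟩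
      exact sq_pos_of_ne_zero hσ
    have hstep : ∀ i, contract (U i) g ≠ 0 →
        (c - lam i) * ∑ ρ, contract (U i) g ρ ^ 2 < energy U lam (contract (U i) g) := by
      intro i hi
      refine ih _ _ (hg.contract _) hi fun l hlen hsum => ?_
      rw [← coord_cons]
      refine hl _ (by simp [hlen]) ?_
      simp only [List.map_cons, List.sum_cons]
      linarith
    have hstep' : ∀ i, (c - lam i) * ∑ ρ, contract (U i) g ρ ^ 2 ≤
        energy U lam (contract (U i) g) := by
      intro i
      by_cases hi : contract (U i) g = 0
      · have hs : ∀ w : V → ℝ, contract w (0 : Finset V → ℝ) = 0 := fun w => by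
          have := contract_smul w 0 (0 : Finset V → ℝ)
          simpa using this
        simp [hi, energy, hs]
      · exact (hstep i hi).le
    have hex : ∃ i, contract (U i) g ≠ 0 := by
      by_contra hc
      push Not at hc
      have h1 := sum_contract_sq hU hg
      simp only [hc, Pi.zero_apply, ne_eq, OfNat.ofNat_ne_zero, not_false_eq_true, zero_pow,
        Finset.sum_const_zero] at h1
      have h2 : (0 : ℝ) < ((p + 1 : ℕ) : ℝ) * ∑ σ, g σ ^ 2 := by positivity
      linarith
    obtain ⟨i₀, hi₀⟩ := hex
    have hlt := Finset.sum_lt_sum (fun i (_ : i ∈ Finset.univ) => hstep' i)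
      ⟨i₀, Finset.mem_univ _, hstep i₀ hi₀⟩
    rw [sum_energy_contract lam hU hg] at hlt
    simp only [sub_mul, Finset.sum_sub_distrib] at hlt
    rw [← Finset.mul_sum, sum_contract_sq hU hg, ← energy] at hlt
    push_cast at hlt
    have hp : (0 : ℝ) < p + 1 := by positivity
    refine lt_of_mul_lt_mul_left ?_ hp.le
    linarith

end Frame

end AbstractSimplicialComplex

/-! ### Counting edges at a face -/

namespace AbstractSimplicialComplex

theorem isFace_singleton {V : Type*} (X : AbstractSimplicialComplex V) (u : V) : X.IsFace {u} :=
  Or.inr (X.singleton_mem u)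

theorem isFace_iff_of_nonempty {V : Type*} {X : AbstractSimplicialComplex V} {σ : Finset V}
    (h : σ.Nonempty) : X.IsFace σ ↔ σ ∈ X := by
  simp [IsFace, h.ne_empty]

variable {V : Type*} [LinearOrder V]

theorem singleton_mem_link {X : AbstractSimplicialComplex V} {σ : Finset V} {u : V} :
    {u} ∈ X.link σ ↔ u ∉ σ ∧ X.IsFace (insert u σ) := by
  simp only [link, Set.mem_ofPred_eq, isFace_singleton, true_and, Finset.union_singleton,
    ← Finset.disjoint_iff_inter_eq_empty, Finset.disjoint_singleton_right]
  exact and_comm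

theorem adj_iff {X : AbstractSimplicialComplex V} {u v : V} :
    X.skeletonGraph.Adj u v ↔ u ≠ v ∧ X.IsFace {u, v} := by
  rw [isFace_iff_of_nonempty (by simp)]
  rfl

theorem singleton_mem_link_singleton {X : AbstractSimplicialComplex V} {u v : V} :
    {u} ∈ X.link {v} ↔ X.skeletonGraph.Adj v u := by
  rw [singleton_mem_link, adj_iff, Finset.mem_singleton, Finset.pair_comm, ne_comm]

/-- The edges `uv` for which `ρ ∪ {u}` and `ρ ∪ {v}` are faces but `ρ ∪ {u, v}` is not. -/
def OpenEdge (X : AbstractSimplicialComplex V) (ρ : Finset V) (u v : V) : Prop :=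
  u ∉ ρ ∧ v ∉ ρ ∧ X.skeletonGraph.Adj u v ∧ X.IsFace (insert u ρ) ∧ X.IsFace (insert v ρ) ∧
    ¬ X.IsFace (insert u (insert v ρ))

theorem OpenEdge.symm {X : AbstractSimplicialComplex V} {ρ : Finset V} {u v : V}
    (h : X.OpenEdge ρ u v) : X.OpenEdge ρ v u := by
  obtain ⟨h1, h2, h3, h4, h5, h6⟩ := h
  exact ⟨h2, h1, h3.symm, h5, h4, by rwa [Finset.insert_comm]⟩

theorem OpenEdge.singleton_mem_link {X : AbstractSimplicialComplex V} {σ : Finset V} {u v : V}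
    (h : X.OpenEdge (σ.erase u) u v) : {v} ∈ X.link (σ \ {u}) := by
  rw [Finset.sdiff_singleton_eq_erase, AbstractSimplicialComplex.singleton_mem_link]
  exact ⟨h.2.1, h.2.2.2.2.1⟩

theorem OpenEdge.adj_of_mem {X : AbstractSimplicialComplex V} {σ : Finset V} {u v w : V}
    (h : X.OpenEdge (σ.erase u) u v) (hw : w ∈ σ) : X.skeletonGraph.Adj w v := by
  by_cases hwu : w = u
  · rw [hwu]
    exact h.2.2.1
  · have hw' : w ∈ σ.erase u := Finset.mem_erase.mpr ⟨hwu, hw⟩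
    refine adj_iff.mpr ⟨fun hwv => h.2.1 (hwv ▸ hw'), h.2.2.2.2.1.mono ?_⟩
    intro x hx
    simp only [Finset.mem_insert, Finset.mem_singleton] at hx
    rcases hx with rfl | rfl
    · exact Finset.mem_insert_of_mem hw'
    · exact Finset.mem_insert_self _ _

variable [Fintype V]

-- If `v` misses a vertex of `σ`, there are at most `k` adjacencies and no open edge. If `v` is
-- adjacent to all of `σ`, either it lies in the link, with `k + 1` adjacencies and no open edge, or
-- it lies in some `σ[j]`, with at most `j` open edges: this is the weight `j + 1`.
open Classical in
theorem card_adj_add_card_openEdge_le (X : AbstractSimplicialComplex V) {k : ℕ} {σ : Finset V}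
    (hσ : σ ∈ X.facesCard (k + 1)) (v : V) :
    (∑ u ∈ σ, ((if X.skeletonGraph.Adj u v then 1 else 0) +
      if X.OpenEdge (σ.erase u) u v then 1 else 0)) ≤
    k + (if v ∉ σ ∧ X.IsFace (insert v σ) then 1 else 0) +
      ∑ j ∈ Finset.range (k + 2), (j + 1) * if v ∈ X.defect σ j then 1 else 0 := by
  have hcard : σ.card = k + 1 := (mem_facesCard.mp hσ).2
  rw [Finset.sum_add_distrib, Finset.sum_boole, Finset.sum_boole, Nat.cast_id, Nat.cast_id]
  have hedge : ∀ u ∈ σ, X.OpenEdge (σ.erase u) u v →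
      v ∉ σ ∧ ¬ X.IsFace (insert v σ) := by
    intro u hu h
    have h1 : v ∉ σ := by
      intro hv
      by_cases hvu : v = u
      · exact h.2.2.1.ne hvu.symm
      · exact h.2.1 (Finset.mem_erase.mpr ⟨hvu, hv⟩)
    refine ⟨h1, ?_⟩
    have h6 := h.2.2.2.2.2
    rwa [Finset.insert_comm, Finset.insert_erase hu] at h6
  by_cases hall : ∀ u ∈ σ, X.skeletonGraph.Adj u v
  · have hvσ : v ∉ σ := fun hv => (hall v hv).ne rfl
    rw [Finset.filter_true_of_mem hall, hcard]
    by_cases hface : X.IsFace (insert v σ)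
    · rw [Finset.filter_false_of_mem fun u hu h => (hedge u hu h).2 hface, if_pos ⟨hvσ, hface⟩]
      simp
    · rw [if_neg fun h => hface h.2]
      let j := (σ.filter fun w => ({v} : Finset V) ∈ X.link (σ \ {w})).card
      have hj : j ∈ Finset.range (k + 2) := by
        have : j ≤ σ.card := Finset.card_filter_le _ _
        rw [Finset.mem_range]
        omega
      have hmem : v ∈ X.defect σ j := by
        simp only [defect, Finset.mem_filter, Finset.mem_univ, true_and]
        refine ⟨fun h => hface (singleton_mem_link.mp h).2,
          fun w hw => singleton_mem_link_singleton.mpr (hall w hw), ?_⟩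
        simp only [j]
      have h1 : (σ.filter fun u => X.OpenEdge (σ.erase u) u v).card ≤ j :=
        Finset.card_le_card (Finset.monotone_filter_right _ fun u _ h => h.singleton_mem_link)
      have h2 := Finset.single_le_sum (s := Finset.range (k + 2))
        (f := fun j => (j + 1) * if v ∈ X.defect σ j then 1 else 0) (fun _ _ => Nat.zero_le _) hj
      simp only [hmem, if_true, mul_one] at h2
      omega
  · have h1 : (σ.filter fun u => X.skeletonGraph.Adj u v).card < σ.card :=
      Finset.card_lt_card (Finset.filter_ssubset.mpr (by push Not at hall; exact hall))
    rw [Finset.filter_false_of_mem (p := fun u => X.OpenEdge (σ.erase u) u v)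
      fun u _ h => hall fun w hw => h.adj_of_mem hw]
    rw [Finset.card_empty]
    omega

open Classical in
theorem sum_adj_add_openEdge_le (X : AbstractSimplicialComplex V) {k : ℕ} {σ : Finset V}
    (hσ : σ ∈ X.facesCard (k + 1)) :
    (∑ u ∈ σ, ∑ v, ((if X.skeletonGraph.Adj u v then 1 else 0) +
      if X.OpenEdge (σ.erase u) u v then 1 else 0)) ≤
    k * Fintype.card V + X.maxDefect k +
      ∑ v, if v ∉ σ ∧ X.IsFace (insert v σ) then 1 else 0 := by
  have h1 : ∑ j ∈ Finset.range (k + 2), (j + 1) * (X.defect σ j).card ≤ X.maxDefect k :=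
    Finset.le_sup (f := fun σ => ∑ j ∈ Finset.range (k + 2), (j + 1) * (X.defect σ j).card) hσ
  have h2 : ∑ j ∈ Finset.range (k + 2), (j + 1) * (X.defect σ j).card =
      ∑ v, ∑ j ∈ Finset.range (k + 2), (j + 1) * if v ∈ X.defect σ j then 1 else 0 := by
    rw [Finset.sum_comm]
    refine Finset.sum_congr rfl fun j _ => ?_
    rw [← Finset.mul_sum, Finset.sum_boole, Finset.filter_univ_mem, Nat.cast_id]
  have h3 := Finset.sum_le_sum fun v (_ : v ∈ Finset.univ) =>
    X.card_adj_add_card_openEdge_le hσ v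
  rw [Finset.sum_add_distrib, Finset.sum_add_distrib, ← h2, Finset.sum_const, Finset.card_univ,
    smul_eq_mul, mul_comm] at h3
  rw [Finset.sum_comm]
  omega

/-! ### Upper bound for the energy of a harmonic cochain -/

open Classical in
theorem dotProduct_lapAddOnes_mulVec (X : AbstractSimplicialComplex V) (h : V → ℝ) :
    h ⬝ᵥ X.lapAddOnes.mulVec h =
      ∑ u, ∑ v, (if X.skeletonGraph.Adj u v then h u ^ 2 - h u * h v else 0) +
        (∑ u, h u) ^ 2 := by
  have h1 : ∀ u, X.lapAddOnes.mulVec h u =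
      ∑ v, (if X.skeletonGraph.Adj u v then h u - h v else 0) + ∑ v, h v := by
    intro u
    have h2 : (X.skeletonGraph.lapMatrix ℝ).mulVec h u =
        ∑ v, (if X.skeletonGraph.Adj u v then h u - h v else 0) := by
      rw [SimpleGraph.lapMatrix_mulVec_apply, SimpleGraph.degree_eq_sum_if_adj, Finset.sum_mul,
        SimpleGraph.neighborFinset_eq_filter, Finset.sum_filter, ← Finset.sum_sub_distrib]
      refine Finset.sum_congr rfl fun v _ => ?_
      split_ifs <;> simp
    rw [← h2, lapAddOnes, Matrix.add_mulVec, Pi.add_apply]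
    congr 1
    simp [Matrix.mulVec, dotProduct]
  simp only [dotProduct, h1, mul_add, Finset.sum_add_distrib, ← Finset.sum_mul, ← sq]
  congr 1
  refine Finset.sum_congr rfl fun u _ => ?_
  rw [Finset.mul_sum]
  refine Finset.sum_congr rfl fun v _ => ?_
  split_ifs <;> ring

-- Expansion of the vanishing sum of squares of the coboundary over faces `τ`: diagonal terms count
-- cofaces, and off-diagonal ones pair `ρ ∪ {u}` with `ρ ∪ {v}` inside `τ = ρ ∪ {u, v}`.
open Classical in
theorem sum_coface_sq (X : AbstractSimplicialComplex V) (g : Finset V → ℝ)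
    (hg : ∀ τ, X.IsFace τ → ∑ u ∈ τ, sign τ u * g (τ.erase u) = 0) :
    ∑ σ, (g σ ^ 2 * ∑ u, if u ∉ σ ∧ X.IsFace (insert u σ) then 1 else 0) =
      ∑ ρ, ∑ u, ∑ v, if u ≠ v ∧ X.IsFace (insert u (insert v ρ)) then
        slice g ρ u * slice g ρ v else 0 := by
  let c : Finset V → ℝ := fun τ => if X.IsFace τ then 1 else 0
  have h0 : ∑ τ, ∑ u ∈ τ, c τ * (sign τ u * g (τ.erase u) *
      ∑ v ∈ τ, sign τ v * g (τ.erase v)) = 0 := by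
    refine Finset.sum_eq_zero fun τ _ => Finset.sum_eq_zero fun u _ => ?_
    by_cases hτ : X.IsFace τ
    · rw [hg τ hτ]
      ring
    · simp [c, hτ]
  rw [← sum_compl_insert fun τ u => c τ * (sign τ u * g (τ.erase u) *
      ∑ v ∈ τ, sign τ v * g (τ.erase v))] at h0
  have h1 : ∀ σ : Finset V, ∑ u, (if u ∈ σ then 0 else c (insert u σ) *
      (sign (insert u σ) u * g ((insert u σ).erase u) *
        ∑ v ∈ insert u σ, sign (insert u σ) v * g ((insert u σ).erase v))) =
      g σ ^ 2 * (∑ u, if u ∉ σ ∧ X.IsFace (insert u σ) then 1 else 0) +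
      ∑ v ∈ σ, g σ * ∑ u, if u ∈ σ then 0 else c (insert u σ) * (sign σ u *
        (sign (insert u σ) v * g ((insert u σ).erase v))) := by
    intro σ
    simp only [Finset.mul_sum]
    rw [Finset.sum_comm (s := σ), ← Finset.sum_add_distrib]
    refine Finset.sum_congr rfl fun u _ => ?_
    by_cases hu : u ∈ σ
    · simp [hu]
    · simp only [hu, if_false, not_false_eq_true, true_and, Finset.sum_insert hu,
        Finset.erase_insert hu, sign_insert_self, ← Finset.mul_sum]
      have hs := sign_mul_self σ u
      by_cases hf : X.IsFace (insert u σ)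
      · simp only [c, hf, if_true]
        linear_combination g σ ^ 2 * hs
      · simp [c, hf]
  simp only [h1, Finset.sum_add_distrib] at h0
  rw [← sum_compl_insert fun σ v => g σ * ∑ u, if u ∈ σ then 0 else c (insert u σ) * (sign σ u *
        (sign (insert u σ) v * g ((insert u σ).erase v)))] at h0
  rw [eq_neg_of_add_eq_zero_left h0, ← Finset.sum_neg_distrib]
  refine Finset.sum_congr rfl fun ρ _ => ?_
  rw [Finset.sum_comm, ← Finset.sum_neg_distrib]
  refine Finset.sum_congr rfl fun v _ => ?_
  by_cases hv : v ∈ ρ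
  · simp [hv, slice]
  rw [if_neg hv, Finset.mul_sum, ← Finset.sum_neg_distrib]
  refine Finset.sum_congr rfl fun u _ => ?_
  by_cases huv : u = v
  · simp [huv]
  by_cases hu : u ∈ ρ
  · simp [hu, slice]
  have he : (insert u (insert v ρ)).erase v = insert u ρ := by
    rw [Finset.insert_comm, Finset.erase_insert (by simp [hv, Ne.symm huv])]
  have hs : sign (insert u (insert v ρ)) v = sign (insert u ρ) v := by
    rw [Finset.insert_comm, sign_insert_self]
  simp only [Finset.mem_insert, huv, hu, or_self, if_false, he, hs, slice, hv, ne_eq,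
    not_false_eq_true, true_and]
  by_cases hf : X.IsFace (insert u (insert v ρ))
  · simp only [c, hf, if_true]
    have h2 := sign_mul_sign_insert hu hv huv
    have h3 := sign_mul_self ρ v
    have h4 := sign_mul_self ρ u
    -- This minus sign is what moves the off-diagonal terms to the other side with the sign of the
    -- slice products.
    have h5 : sign (insert v ρ) u * sign (insert u ρ) v = -(sign ρ u * sign ρ v) := by
      linear_combination (-(sign (insert v ρ) u * sign (insert u ρ) v)) * h3 +
        (sign ρ v * sign (insert u ρ) v) * h2 - sign ρ u * sign ρ v *
          sign_mul_self (insert u ρ) v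
    linear_combination (-(g (insert v ρ) * g (insert u ρ))) * h5
  · simp [c, hf]

theorem sum_dotProduct_lapAddOnes_le (X : AbstractSimplicialComplex V) {k : ℕ}
    {g : Finset V → ℝ} (hsupp : ∀ σ, g σ ≠ 0 → σ ∈ X.facesCard (k + 1))
    (hcyc : ∀ ρ, ∑ u, slice g ρ u = 0)
    (hcocyc : ∀ τ, X.IsFace τ → ∑ u ∈ τ, sign τ u * g (τ.erase u) = 0) :
    ∑ ρ, slice g ρ ⬝ᵥ X.lapAddOnes.mulVec (slice g ρ) ≤
      (k * Fintype.card V + X.maxDefect k) * ∑ σ, g σ ^ 2 := by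
  classical
  simp only [dotProduct_lapAddOnes_mulVec, hcyc]
  let a : V → V → ℝ := fun u v => if X.skeletonGraph.Adj u v then 1 else 0
  let e : Finset V → V → V → ℝ := fun ρ u v => if X.OpenEdge ρ u v then 1 else 0
  have he : ∀ ρ u v, e ρ u v = e ρ v u := by
    intro ρ u v
    simp only [e]
    congr 1
    exact propext ⟨OpenEdge.symm, OpenEdge.symm⟩
  -- Cross terms cancel when `ρ ∪ {u, v}` is a face. On an open edge, `-xy ≤ (x² + y²)/2` is used; a
  -- non-edge with nonzero slice product contributes nothing.
  have hpt : ∀ ρ u v, (if X.skeletonGraph.Adj u v then slice g ρ u ^ 2 - slice g ρ u * slice g ρ v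
        else 0) + (if u ≠ v ∧ X.IsFace (insert u (insert v ρ)) then
        slice g ρ u * slice g ρ v else 0) ≤
      a u v * slice g ρ u ^ 2 + e ρ u v * (slice g ρ u ^ 2 + slice g ρ v ^ 2) / 2 := by
    intro ρ u v
    by_cases hz : slice g ρ u * slice g ρ v = 0
    · have : 0 ≤ e ρ u v := by
        simp only [e]
        split_ifs <;> simp
      have h2 : 0 ≤ e ρ u v * (slice g ρ u ^ 2 + slice g ρ v ^ 2) / 2 := by positivity
      simp only [hz, sub_zero, ite_self, add_zero, a, ite_mul, one_mul, zero_mul]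
      linarith
    · have hmem : ∀ w, slice g ρ w ≠ 0 → w ∉ ρ ∧ X.IsFace (insert w ρ) := by
        intro w hw
        simp only [slice, ne_eq, ite_eq_left_iff, not_forall] at hw
        obtain ⟨h1, h2⟩ := hw
        exact ⟨h1, (mem_facesCard.mp (hsupp _ (right_ne_zero_of_mul h2))).1⟩
      obtain ⟨hu, hfu⟩ := hmem u (left_ne_zero_of_mul hz)
      obtain ⟨hv, hfv⟩ := hmem v (right_ne_zero_of_mul hz)
      by_cases hadj : X.skeletonGraph.Adj u v
      · by_cases hf : X.IsFace (insert u (insert v ρ))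
        · have h1 : ¬ X.OpenEdge ρ u v := fun h => h.2.2.2.2.2 hf
          simp [a, e, hadj, hf, h1, hadj.ne]
        · have h1 : X.OpenEdge ρ u v := ⟨hu, hv, hadj, hfu, hfv, hf⟩
          simp only [a, e, hadj, hf, h1, if_true, and_false, if_false]
          nlinarith [sq_nonneg (slice g ρ u + slice g ρ v)]
      · have h1 : ¬ X.OpenEdge ρ u v := fun h => hadj h.2.2.1
        have h2 : ¬ (u ≠ v ∧ X.IsFace (insert u (insert v ρ))) := fun h =>
          hadj (adj_iff.mpr ⟨h.1, h.2.mono (by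
            intro x hx
            simp only [Finset.mem_insert, Finset.mem_singleton] at hx ⊢
            tauto)⟩)
        simp [a, e, hadj, h1, h2]
  have hsum := Finset.sum_le_sum fun ρ (_ : ρ ∈ Finset.univ) => Finset.sum_le_sum
    fun u (_ : u ∈ Finset.univ) => Finset.sum_le_sum fun v (_ : v ∈ Finset.univ) => hpt ρ u v
  have hsymm : ∀ ρ, ∑ u, ∑ v, e ρ u v * (slice g ρ u ^ 2 + slice g ρ v ^ 2) / 2 =
      ∑ u, ∑ v, e ρ u v * slice g ρ u ^ 2 := by
    intro ρ
    have h1 : ∑ u, ∑ v, e ρ u v * slice g ρ v ^ 2 = ∑ u, ∑ v, e ρ u v * slice g ρ u ^ 2 := by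
      rw [Finset.sum_comm]
      exact Finset.sum_congr rfl fun u _ => Finset.sum_congr rfl fun v _ => by rw [he]
    simp only [mul_add, add_div, Finset.sum_add_distrib, ← Finset.sum_div, h1]
    ring
  simp only [Finset.sum_add_distrib, hsymm] at hsum
  rw [← X.sum_coface_sq g hcocyc, ← Finset.sum_add_distrib] at hsum
  -- Only squares remain, so they regroup by the face `σ = ρ ∪ {u}`, where the local count applies.
  have hre : ∑ ρ, (∑ u, ∑ v, a u v * slice g ρ u ^ 2 + ∑ u, ∑ v, e ρ u v * slice g ρ u ^ 2) =
      ∑ σ, ∑ u ∈ σ, g σ ^ 2 * ∑ v, (a u v + e (σ.erase u) u v) := by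
    rw [← sum_compl_insert fun σ u => g σ ^ 2 * ∑ v, (a u v + e (σ.erase u) u v)]
    refine Finset.sum_congr rfl fun ρ _ => ?_
    rw [← Finset.sum_add_distrib]
    refine Finset.sum_congr rfl fun u _ => ?_
    rw [← Finset.sum_add_distrib]
    simp only [← add_mul, ← Finset.sum_mul, slice_sq]
    split_ifs with hu
    · simp
    · rw [Finset.erase_insert hu, mul_comm]
  have hcount : ∀ σ, ∑ u ∈ σ, g σ ^ 2 * ∑ v, (a u v + e (σ.erase u) u v) ≤
      (k * Fintype.card V + X.maxDefect k) * g σ ^ 2 +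
        g σ ^ 2 * ∑ u, if u ∉ σ ∧ X.IsFace (insert u σ) then 1 else 0 := by
    intro σ
    by_cases hσ : g σ = 0
    · simp [hσ]
    · have h1 : (∑ u ∈ σ, ∑ v, (a u v + e (σ.erase u) u v)) ≤
          k * Fintype.card V + X.maxDefect k +
            ∑ v, if v ∉ σ ∧ X.IsFace (insert v σ) then (1 : ℝ) else 0 := by
        have := X.sum_adj_add_openEdge_le (hsupp σ hσ)
        simp only [a, e]
        exact_mod_cast this
      rw [← Finset.mul_sum]
      nlinarith [mul_le_mul_of_nonneg_left h1 (sq_nonneg (g σ))]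
  have hfin := Finset.sum_le_sum fun σ (_ : σ ∈ Finset.univ) => hcount σ
  rw [Finset.sum_add_distrib, ← Finset.mul_sum] at hfin
  simp only [Finset.sum_add_distrib] at hsum hre hfin ⊢
  simp only [ne_eq, OfNat.ofNat_ne_zero, not_false_eq_true, zero_pow, Finset.sum_const_zero]
  linarith

end AbstractSimplicialComplex

/-! ### Harmonic representatives and conclusion -/

/-- `Φ` together with pairing against `B` embeds `Z` into `ℝ^κ × B*`, so `dim Z ≤ |κ| + dim B`; no
orthogonal complement has to be formed. -/
theorem finrank_quotient_le_card {b κ : Type*} [Fintype b] [Fintype κ]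
    {Z : Submodule ℝ (b → ℝ)} (B : Submodule ℝ Z) (Φ : (b → ℝ) →ₗ[ℝ] (κ → ℝ))
    (h : ∀ z ∈ Z, (∀ y ∈ B, z ⬝ᵥ y.1 = 0) → Φ z = 0 → z = 0) :
    Module.finrank ℝ (Z ⧸ B) ≤ Fintype.card κ := by
  let Ψ : Z →ₗ[ℝ] (κ → ℝ) × Module.Dual ℝ B := (Φ.comp Z.subtype).prod
    (((Z.subtype.comp B.subtype).dualMap.comp (dotProductBilin ℝ ℝ)).comp Z.subtype)
  have hΨ : Function.Injective Ψ := by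
    rw [← LinearMap.ker_eq_bot, LinearMap.ker_eq_bot']
    rintro ⟨z, hz⟩ h0
    have h1 := (Prod.mk_eq_zero.mp h0).1
    have h2 := (Prod.mk_eq_zero.mp h0).2
    exact Subtype.ext (h z hz (fun y hy => LinearMap.congr_fun h2 ⟨y, hy⟩) h1)
  have h1 := LinearMap.finrank_le_finrank_of_injective hΨ
  have h3 : Module.finrank ℝ (Module.Dual ℝ B) = Module.finrank ℝ B :=
    Subspace.dual_finrank_eq (K := ℝ) (V := B)
  rw [Module.finrank_prod, h3, Module.finrank_pi] at h1
  have h2 := B.finrank_quotient_add_finrank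
  omega

namespace AbstractSimplicialComplex

variable {V : Type*} [LinearOrder V] [Fintype V]

open Classical in
/-- Extension of a cochain by zero to all finite sets of vertices. -/
noncomputable def extendZero (X : AbstractSimplicialComplex V) (p : ℕ) :
    X.Cochain p →ₗ[ℝ] (Finset V → ℝ) where
  toFun f σ := if h : σ ∈ X.facesCard p then f ⟨σ, h⟩ else 0
  map_add' f f' := by
    funext σ
    by_cases h : σ ∈ X.facesCard p <;> simp [h]
  map_smul' c f := by
    funext σ
    by_cases h : σ ∈ X.facesCard p <;> simp [h]

variable {X : AbstractSimplicialComplex V} {p : ℕ}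

theorem extendZero_coe (f : X.Cochain p) (σ : {σ : Finset V // σ ∈ X.facesCard p}) :
    X.extendZero p f σ = f σ := dif_pos σ.2

theorem extendZero_of_notMem (f : X.Cochain p) {σ : Finset V} (h : σ ∉ X.facesCard p) :
    X.extendZero p f σ = 0 := dif_neg h

theorem mem_of_extendZero_ne_zero {f : X.Cochain p} {σ : Finset V}
    (h : X.extendZero p f σ ≠ 0) : σ ∈ X.facesCard p :=
  by_contra fun hσ => h (extendZero_of_notMem f hσ)

theorem coboundary_apply_eq_sum (f : X.Cochain p)
    (τ : {σ : Finset V // σ ∈ X.facesCard (p + 1)}) :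
    X.coboundary p f τ = ∑ u ∈ τ.1, sign τ.1 u * X.extendZero p f (τ.1.erase u) := by
  rw [← Finset.sum_coe_sort τ.1]
  refine Finset.sum_congr rfl fun u _ => ?_
  exact congrArg _ (extendZero_coe f ⟨_, erase_mem_facesCard τ.2 u.2⟩).symm

theorem sum_sign_mul_extendZero_erase {f : X.Cochain p} (hf : X.coboundary p f = 0)
    {τ : Finset V} (hτ : X.IsFace τ) :
    ∑ u ∈ τ, sign τ u * X.extendZero p f (τ.erase u) = 0 := by
  by_cases hcard : τ.card = p + 1
  · rw [← coboundary_apply_eq_sum f ⟨τ, mem_facesCard.mpr ⟨hτ, hcard⟩⟩, hf, Pi.zero_apply]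
  · refine Finset.sum_eq_zero fun u hu => ?_
    rw [extendZero_of_notMem, mul_zero]
    intro h
    have := (mem_facesCard.mp h).2
    have := Finset.card_erase_add_one hu
    omega

/-- Adjointness of boundary and coboundary: the sum of a slice at `ρ` is the boundary at `ρ`. -/
theorem dotProduct_coboundary (f : X.Cochain (p + 1)) (y : X.Cochain p) :
    f ⬝ᵥ X.coboundary p y =
      ∑ ρ, X.extendZero p y ρ * ∑ u, slice (X.extendZero (p + 1) f) ρ u := by
  have h1 : f ⬝ᵥ X.coboundary p y = ∑ σ, ∑ u ∈ σ,
      X.extendZero (p + 1) f σ * (sign σ u * X.extendZero p y (σ.erase u)) := by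
    simp only [← Finset.mul_sum]
    rw [← Finset.sum_subset (Finset.subset_univ (X.facesCard (p + 1))) fun σ _ hσ => by
      rw [extendZero_of_notMem f hσ, zero_mul], ← Finset.sum_coe_sort (X.facesCard (p + 1))]
    refine Finset.sum_congr rfl fun σ _ => ?_
    rw [coboundary_apply_eq_sum, extendZero_coe]
  rw [h1, ← sum_compl_insert fun σ u =>
    X.extendZero (p + 1) f σ * (sign σ u * X.extendZero p y (σ.erase u))]
  refine Finset.sum_congr rfl fun ρ _ => ?_
  rw [Finset.mul_sum]
  refine Finset.sum_congr rfl fun u _ => ?_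
  rw [slice]
  split_ifs with hu
  · simp
  · rw [sign_insert_self, Finset.erase_insert hu]
    ring

/-- At a face `ρ` of the right size, test against its indicator; otherwise heredity makes every term
zero. -/
theorem sum_slice_extendZero {f : X.Cochain (p + 1)}
    (hf : ∀ y, f ⬝ᵥ X.coboundary p y = 0) (ρ : Finset V) :
    ∑ u, slice (X.extendZero (p + 1) f) ρ u = 0 := by
  classical
  by_cases hρ : ρ ∈ X.facesCard p
  · have h1 := hf (Pi.single ⟨ρ, hρ⟩ 1)
    rw [dotProduct_coboundary, Finset.sum_eq_single ρ] at h1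
    · have h2 := extendZero_coe (Pi.single ⟨ρ, hρ⟩ 1 : X.Cochain p) ⟨ρ, hρ⟩
      rw [Pi.single_eq_same] at h2
      simpa [h2] using h1
    · intro ρ' _ hne
      by_cases hρ' : ρ' ∈ X.facesCard p
      · rw [extendZero_coe _ ⟨ρ', hρ'⟩, Pi.single_eq_of_ne (by simpa using hne), zero_mul]
      · rw [extendZero_of_notMem _ hρ', zero_mul]
    · simp
  · refine Finset.sum_eq_zero fun u _ => ?_
    rw [slice]
    split_ifs with hu
    · rfl
    · rw [extendZero_of_notMem, mul_zero]
      intro h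
      have := erase_mem_facesCard h (Finset.mem_insert_self u ρ)
      rw [Finset.erase_insert hu] at this
      exact hρ this

end AbstractSimplicialComplex

open AbstractSimplicialComplex in
theorem corollary1p6 {V : Type*} [Fintype V] [LinearOrder V]
    (X : AbstractSimplicialComplex V) (k : ℕ) :
    Module.finrank ℝ (X.ReducedCohomology k) ≤
      ((Finset.powersetCard (k + 1) (Finset.univ : Finset (Fin (Fintype.card V)))).filter
        fun A => ∑ i ∈ A, ascEigenvalue X.isHermitian_lapAddOnes i ≤
          (k : ℝ) * (Fintype.card V : ℝ) + (X.maxDefect k : ℝ)).card := by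
  obtain ⟨U, hU, hM⟩ := exists_eigenframe X.isHermitian_lapAddOnes
  set good := (Finset.powersetCard (k + 1) (Finset.univ : Finset (Fin (Fintype.card V)))).filter
    fun A => ∑ i ∈ A, ascEigenvalue X.isHermitian_lapAddOnes i ≤
      (k : ℝ) * (Fintype.card V : ℝ) + (X.maxDefect k : ℝ) with hgood
  -- The order chosen by `toList` affects a coordinate only up to sign.
  let Φ : X.Cochain (k + 1) →ₗ[ℝ] (good → ℝ) :=
    (LinearMap.pi fun A : good => coord U A.1.toList).comp (X.extendZero (k + 1))
  rw [← Fintype.card_coe good]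
  refine finrank_quotient_le_card _ Φ fun f hf horth hΦ => ?_
  have hcyc := sum_slice_extendZero fun y => horth _ ⟨y, rfl⟩
  have hsupp : ∀ σ, X.extendZero (k + 1) f σ ≠ 0 → σ ∈ X.facesCard (k + 1) :=
    fun _ h => mem_of_extendZero_ne_zero h
  have hle := X.sum_dotProduct_lapAddOnes_le hsupp hcyc
    fun τ hτ => sum_sign_mul_extendZero_erase hf hτ
  rw [← energy_eq U _ hM] at hle
  have hzero : X.extendZero (k + 1) f = 0 := by
    by_contra hne
    refine absurd hle (not_le.mpr (mul_lt_energy _ hU (k + 1) _ _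
      (fun σ h => (mem_facesCard.mp (hsupp σ h)).2) hne fun l hlen hsum => ?_))
    -- A list without repetition is an ordering of some `A` in `good`; with a repetition its
    -- coordinate vanishes by antisymmetry.
    by_cases hl : l.Nodup
    · have hmem : l.toFinset ∈ good := by
        rw [hgood, Finset.mem_filter, Finset.mem_powersetCard]
        refine ⟨⟨Finset.subset_univ _, by rw [List.toFinset_card_of_nodup hl, hlen]⟩, ?_⟩
        rwa [List.sum_toFinset _ hl]
      exact coord_eq_zero_of_perm U (List.toFinset_toList hl) _ (congrFun hΦ ⟨_, hmem⟩)
    · exact coord_eq_zero_of_not_nodup U hl _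
  funext σ
  have hσ := extendZero_coe f σ
  rw [hzero] at hσ
  exact hσ.symm
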